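/- All graphs are finite, undirected and simple. For a graph $G$, let the entanglement-assisted independence number $\alpha^*(G)$ be the maximum $m\in\mathbb{N}$ such that there exist positive semidefinite operators $\rho$ and $\rho_i^u$ ($i\in[m]$, $u\in V(G)$) on a finite-dimensional complex Hilbert space with $\mathrm{Tr}(\rho)=1$, $\sum_{u\in V(G)}\rho_i^u=\rho$ for all $i\in[m]$, and $\rho_i^u\rho_j^v=0$ for all $i\neq j$ in $[m]$ and all $u,v\in V(G)$ that are equal or adjacent. Let $G^{\boxtimes n}$ be the $n$-th strong power of $G$: its vertex set is $V(G)^n$, and distinct vertices $(u_1,\dots,u_n)$, $(v_1,\dots,v_n)$ are adjacent if for every $i$ the vertices $u_i,v_i$ are equal or adjacent in $G$. Let $G^{+t}$ be the disjoint union of $t$ copies of $G$. Let $\Omega_k$ be the graph with vertex set $\{\pm1\}^k$ in which two vertices are adjacent if they are orthogonal as vectors of $\mathbb{R}^k$. Theorem. Let $k$ be a positive multiple of $4$ that is not a power of $2$. Then for every integer $n\ge 1$, $$\alpha^*\big((\Omega_k^{+k})^{\boxtimes n}\big) > k^n\cdot \alpha^*\big(\Omega_k^{\boxtimes n}\big).$$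 -/

import Mathlib

open scoped ComplexOrder

/-- The orthogonality graph `Ω_k`: its vertices are the vectors of `{±1}^k`, and two distinct
vertices are adjacent when their inner product vanishes. (For `k ≥ 1` orthogonal vectors are
automatically distinct.) -/
def orthogonalityGraph (k : ℕ) : SimpleGraph (Fin k → ℤˣ) where
  Adj u v := u ≠ v ∧ ∑ i, ((u i : ℤ) : ℝ) * ((v i : ℤ) : ℝ) = 0
  symm := ⟨fun u v h => ⟨h.1.symm, by simpa only [mul_comm] using h.2⟩⟩
  loopless := ⟨fun _ h => h.1 rfl⟩

/-- The `n`-th strong graph power `G^{⊠ n}`. -/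
def strongPower {V : Type*} (G : SimpleGraph V) (n : ℕ) : SimpleGraph (Fin n → V) where
  Adj x y := x ≠ y ∧ ∀ i, x i = y i ∨ G.Adj (x i) (y i)
  symm := ⟨fun _ _ h => ⟨h.1.symm, fun i => (h.2 i).imp Eq.symm fun a => a.symm⟩⟩
  loopless := ⟨fun _ h => h.1 rfl⟩

/-- The disjoint union `G^{+t}` of `t` copies of `G`. -/
def disjointCopies {V : Type*} (G : SimpleGraph V) (t : ℕ) : SimpleGraph (V × Fin t) where
  Adj x y := G.Adj x.1 y.1 ∧ x.2 = y.2
  symm := ⟨fun _ _ h => ⟨h.1.symm, h.2.symm⟩⟩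
  loopless := ⟨fun x h => G.loopless.irrefl x.1 h.1⟩

/-- `m` messages can be sent with zero error by one use of a channel with confusability graph `G`
with the help of entanglement: on some finite-dimensional Hilbert space `ℂ^d` there are positive
semidefinite operators `ρ` and `ρ_i^u` (here `σ i u`) with `Tr ρ = 1`, `∑_u ρ_i^u = ρ` for all `i`,
and `ρ_i^u ρ_j^v = 0` whenever `i ≠ j` and `u`, `v` are equal or adjacent. -/
def EntangledSendable {V : Type*} [Fintype V] (G : SimpleGraph V) (m : ℕ) : Prop :=
  ∃ (d : ℕ) (ρ : Matrix (Fin d) (Fin d) ℂ) (σ : Fin m → V → Matrix (Fin d) (Fin d) ℂ),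
    ρ.PosSemidef ∧ (∀ i u, (σ i u).PosSemidef) ∧
    ρ.trace = 1 ∧
    (∀ i, ∑ u, σ i u = ρ) ∧
    (∀ i j, i ≠ j → ∀ u v, u = v ∨ G.Adj u v → σ i u * σ j v = 0)

/-- The entanglement-assisted independence number `α*(G)`: the maximum number of messages that can
be sent (`entIndepNum_isGreatest` shows that this maximum exists). -/
noncomputable def entIndepNum {V : Type*} [Fintype V] (G : SimpleGraph V) : ℕ :=
  sSup {m : ℕ | EntangledSendable G m}

theorem posSemidef_trace_mul_re_nonneg {d : ℕ} {A B : Matrix (Fin d) (Fin d) ℂ}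
    (hA : A.PosSemidef) (hB : B.PosSemidef) : 0 ≤ (A * B).trace.re := by
  obtain ⟨C, rfl⟩ : ∃ C, B = star C * C := by
    open MatrixOrder Matrix.Norms.L2Operator in
    exact CStarAlgebra.nonneg_iff_eq_star_mul_self.mp hB.nonneg
  rw [Matrix.star_eq_conjTranspose]
  rw [← Matrix.mul_assoc, Matrix.trace_mul_comm, ← Matrix.mul_assoc]
  exact (Complex.le_def.mp (hA.mul_mul_conjTranspose_same C).trace_nonneg).1

/-- At most `|V(G)|` messages can be sent, so that the maximum in `α*(G)` is over a bounded set. -/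
theorem EntangledSendable.le_card {V : Type*} [Fintype V] {G : SimpleGraph V} {m : ℕ}
    (h : EntangledSendable G m) : m ≤ Fintype.card V := by
  obtain ⟨d, ρ, σ, hρ, hσ, htr, hsum, hort⟩ := h
  -- the Hilbert-Schmidt inner product
  let T : Matrix (Fin d) (Fin d) ℂ →ₗ[ℂ] EuclideanSpace ℂ (Fin d × Fin d) :=
    { toFun := fun A => WithLp.toLp 2 (fun p => A p.1 p.2)
      map_add' := fun _ _ => rfl
      map_smul' := fun _ _ => rfl }
  have hin : ∀ A B : Matrix (Fin d) (Fin d) ℂ, A.IsHermitian →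
      inner ℂ (T A) (T B) = (A * B).trace := by
    intro A B hA
    simp only [T, PiLp.inner_apply, Matrix.trace, Matrix.diag,
      Matrix.mul_apply, Fintype.sum_prod_type, RCLike.inner_apply]
    rw [Finset.sum_comm]
    refine Finset.sum_congr rfl fun a _ => Finset.sum_congr rfl fun b _ => ?_
    rw [← hA.apply a b, mul_comm]
    rfl
  have hcs : ∀ (f : V → EuclideanSpace ℂ (Fin d × Fin d)),
      ‖∑ u, f u‖ ^ 2 ≤ Fintype.card V * ∑ u, ‖f u‖ ^ 2 := by
    intro f
    calc ‖∑ u, f u‖ ^ 2 ≤ (∑ u, ‖f u‖) ^ 2 := by gcongr; exact norm_sum_le _ _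
      _ ≤ _ := sq_sum_le_card_mul_sum_sq
  have hnorm : ∀ x : EuclideanSpace ℂ (Fin d × Fin d), ‖x‖ ^ 2 = (inner ℂ x x).re := fun x => by
    rw [inner_self_eq_norm_sq_to_K]; norm_cast
  have h1 : ∀ u, ‖∑ i, T (σ i u)‖ ^ 2 = ∑ i, ‖T (σ i u)‖ ^ 2 := by
    intro u
    simp only [hnorm, sum_inner, inner_sum, Complex.re_sum]
    refine Finset.sum_congr rfl fun i _ => ?_
    refine Finset.sum_eq_single i (fun j _ hj => ?_) (by simp)
    rw [hin _ _ (hσ _ u).1, hort _ _ (by tauto) u u (Or.inl rfl)]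
    simp
  have h2 : ∀ i, ∑ u, ‖T (σ i u)‖ ^ 2 ≤ ‖T ρ‖ ^ 2 := by
    intro i
    rw [← hsum i, map_sum]
    simp only [hnorm, sum_inner, inner_sum, Complex.re_sum]
    refine Finset.sum_le_sum fun u _ => ?_
    refine Finset.single_le_sum (f := fun v => (inner ℂ (T (σ i v)) (T (σ i u))).re)
      (fun v _ => ?_) (Finset.mem_univ u)
    rw [hin _ _ (hσ i v).1]
    exact posSemidef_trace_mul_re_nonneg (hσ i v) (hσ i u)
  have h3 : ∑ u, ∑ i, T (σ i u) = (m : ℂ) • T ρ := by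
    rw [Finset.sum_comm]
    simp only [← map_sum, hsum]
    rw [Finset.sum_const, Finset.card_univ, Fintype.card_fin, map_nsmul, Nat.cast_smul_eq_nsmul]
  have hpos : 0 < ‖T ρ‖ ^ 2 := by
    have : T ρ ≠ 0 := fun h0 => by
      have : ρ = 0 := by
        ext a b
        exact congrFun (congrArg WithLp.ofLp h0) (a, b)
      simp [this] at htr
    positivity
  have h4 : (m : ℝ) ^ 2 * ‖T ρ‖ ^ 2 ≤ Fintype.card V * (m * ‖T ρ‖ ^ 2) := by
    calc (m : ℝ) ^ 2 * ‖T ρ‖ ^ 2 = ‖∑ u, ∑ i, T (σ i u)‖ ^ 2 := by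
          rw [h3, norm_smul, mul_pow]; simp
      _ ≤ Fintype.card V * ∑ u, ‖∑ i, T (σ i u)‖ ^ 2 := hcs _
      _ = Fintype.card V * ∑ i, ∑ u, ‖T (σ i u)‖ ^ 2 := by
          simp only [h1]; rw [Finset.sum_comm]
      _ ≤ Fintype.card V * ∑ _i : Fin m, ‖T ρ‖ ^ 2 := by
          gcongr with i; exact h2 i
      _ = _ := by simp
  rcases Nat.eq_zero_or_pos m with rfl | hm
  · exact Nat.zero_le _
  · have hm' : (0 : ℝ) < m * ‖T ρ‖ ^ 2 := by positivity
    have : (m : ℝ) ≤ Fintype.card V := le_of_mul_le_mul_right (by linarith) hm'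
    exact_mod_cast this

/-- The supremum defining `α*(G)` is a maximum. -/
theorem entIndepNum_isGreatest {V : Type*} [Fintype V] (G : SimpleGraph V) :
    IsGreatest {m : ℕ | EntangledSendable G m} (entIndepNum G) := by
  have hb : BddAbove {m : ℕ | EntangledSendable G m} :=
    ⟨Fintype.card V, fun _ hm => EntangledSendable.le_card hm⟩
  have hne : {m : ℕ | EntangledSendable G m}.Nonempty :=
    ⟨0, 1, (1 : Matrix (Fin 1) (Fin 1) ℂ), fun i => i.elim0, Matrix.PosSemidef.one, fun i => i.elim0, by simp,
      fun i => i.elim0, fun i => i.elim0⟩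
  exact ⟨Nat.sSup_mem hne hb, fun _ hm => le_csSup hb hm⟩

/-! The proof separates the two sides at `2 ^ (k * n)`. Upper bound: the Lovász number bounds α*
(`EntangledSendable.le_of_lovaszCertificate`) and is submultiplicative under strong powers. Since
`Ω_k` is a Cayley graph on `{±1}^k`, its spectrum consists of middle Krawtchouk values. Their
minimum is `-1/(k-1)` times the degree, which gives the bound `2^k/k`
(`lovaszCertificate_orthogonalityGraph`), hence `k^n α*(Ω_k^{⊠n}) ≤ 2^{kn}`. Lower bound: twisting
the Fourier basis of `ℂ^k` by the signs `u` gives an orthogonal basis for each vertex `u`, and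
adjacent vertices get bases that are orthogonal index by index. With `k` copies of the graph the
sender can also transmit the measurement outcome, so all `2^k` messages are sent without error, and
tensor powers give `2^{kn}`. Strictness: equality would make `k` divide a power of `2`. -/

/-! ### The Lovász bound for entanglement-assisted codes -/

/-- A weighted Hilbert-Schmidt form satisfies the Cauchy-Schwarz inequality for real linear
combinations. -/
theorem Matrix.PosSemidef.trace_conj_sum_smul_le {d L : Type*} [Fintype d] [Fintype L]
    {P : Matrix d d ℂ} (hP : P.PosSemidef) (c : L → ℝ) (W : L → Matrix d d ℂ) :
    ((∑ l, (c l : ℂ) • W l).conjTranspose * P * (∑ l, (c l : ℂ) • W l)).trace.re ≤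
      (∑ l, c l ^ 2) * ∑ l, ((W l).conjTranspose * P * W l).trace.re := by
  classical
  obtain ⟨B, rfl⟩ : ∃ B, P = star B * B := by
    open MatrixOrder Matrix.Norms.L2Operator in
    exact CStarAlgebra.nonneg_iff_eq_star_mul_self.mp hP.nonneg
  have key : ∀ W : Matrix d d ℂ, (W.conjTranspose * (star B * B) * W).trace.re =
      ∑ a, ∑ b, ‖(B * W) b a‖ ^ 2 := by
    intro W
    have : W.conjTranspose * (star B * B) * W = (B * W).conjTranspose * (B * W) := by
      rw [Matrix.conjTranspose_mul, Matrix.star_eq_conjTranspose]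
      simp only [Matrix.mul_assoc]
    rw [this]
    simp only [Matrix.trace, Matrix.diag, Complex.re_sum]
    refine Finset.sum_congr rfl fun a _ => ?_
    rw [Matrix.mul_apply, Complex.re_sum]
    refine Finset.sum_congr rfl fun b _ => ?_
    rw [Matrix.conjTranspose_apply, Complex.star_def, ← Complex.normSq_eq_conj_mul_self,
      Complex.normSq_eq_norm_sq, Complex.ofReal_re]
  rw [key, Finset.sum_congr rfl fun l _ => key (W l)]
  have hcs : ∀ b a, ‖(B * ∑ l, (c l : ℂ) • W l) b a‖ ^ 2 ≤
      (∑ l, c l ^ 2) * ∑ l, ‖(B * W l) b a‖ ^ 2 := by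
    intro b a
    have : (B * ∑ l, (c l : ℂ) • W l) b a = ∑ l, (c l : ℂ) * (B * W l) b a := by
      rw [Matrix.mul_sum, Matrix.sum_apply]
      simp
    rw [this]
    calc ‖∑ l, (c l : ℂ) * (B * W l) b a‖ ^ 2 ≤ (∑ l, |c l| * ‖(B * W l) b a‖) ^ 2 := by
          gcongr
          refine (norm_sum_le _ _).trans_eq ?_
          simp
      _ ≤ (∑ l, |c l| ^ 2) * ∑ l, ‖(B * W l) b a‖ ^ 2 :=
          Finset.sum_mul_sq_le_sq_mul_sq _ _ _
      _ = _ := by simp only [sq_abs]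
  calc ∑ a, ∑ b, ‖(B * ∑ l, (c l : ℂ) • W l) b a‖ ^ 2
      ≤ ∑ a, ∑ b, (∑ l, c l ^ 2) * ∑ l, ‖(B * W l) b a‖ ^ 2 :=
        Finset.sum_le_sum fun a _ => Finset.sum_le_sum fun b _ => hcs b a
    _ = _ := by
        simp only [← Finset.mul_sum]
        congr 1
        rw [Finset.sum_comm (s := (Finset.univ : Finset L))]
        exact Finset.sum_congr rfl fun a _ => Finset.sum_comm

/-- Every positive semidefinite matrix has a positive semidefinite generalized inverse. -/
theorem Matrix.PosSemidef.exists_generalizedInverse {d : Type*} [Fintype d]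
    {P : Matrix d d ℂ} (hP : P.PosSemidef) :
    ∃ R : Matrix d d ℂ, R.PosSemidef ∧ R * P * R = R ∧ P * R * P = P := by
  classical
  have hsa : IsSelfAdjoint P := hP.1
  have hc : ∀ f : ℝ → ℝ, ContinuousOn f (spectrum ℝ P) := fun f =>
    (Matrix.finite_real_spectrum (A := P)).continuousOn f
  have hid : cfc (fun x : ℝ => x) P = P := cfc_id' ℝ P
  have hmul : ∀ f g : ℝ → ℝ, cfc f P * cfc g P = cfc (fun x => f x * g x) P := fun f g =>
    (cfc_mul f g P (hc f) (hc g)).symm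
  -- The convention `0⁻¹ = 0` makes `x⁻¹ * x * x⁻¹ = x⁻¹` and `x * x⁻¹ * x = x` hold at `0` too, so
  -- `P` may be singular.
  have h1 : cfc (fun x : ℝ => x⁻¹) P * P * cfc (fun x : ℝ => x⁻¹) P =
      cfc (fun x : ℝ => x⁻¹) P := by
    have : cfc (fun x : ℝ => x⁻¹) P * cfc (fun x : ℝ => x) P * cfc (fun x : ℝ => x⁻¹) P =
        cfc (fun x : ℝ => x⁻¹) P := by
      rw [hmul, hmul]
      congr 1
      funext x
      by_cases hx : x = 0 <;> simp [hx]
    rwa [hid] at this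
  have h2 : P * cfc (fun x : ℝ => x⁻¹) P * P = P := by
    have : cfc (fun x : ℝ => x) P * cfc (fun x : ℝ => x⁻¹) P * cfc (fun x : ℝ => x) P =
        cfc (fun x : ℝ => x) P := by
      rw [hmul, hmul]
      congr 1
      funext x
      by_cases hx : x = 0 <;> simp [hx]
    rwa [hid] at this
  have hR : IsSelfAdjoint (cfc (fun x : ℝ => x⁻¹) P) := cfc_predicate _ P
  refine ⟨cfc (fun x : ℝ => x⁻¹) P, ?_, h1, h2⟩
  rw [← h1]
  have := hP.conjTranspose_mul_mul_same (cfc (fun x : ℝ => x⁻¹) P)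
  rwa [← Matrix.star_eq_conjTranspose, hR.star_eq] at this

/-- If `∑ u, σ u = ρ`, `R` is a generalized inverse of `ρ` and the vectors `φ · u` have squared
length at most `t`, then `∑ l, tr (Y l * R * Y l) ≤ t * tr ρ` with `Y l = ∑ u, φ l u • σ u`. -/
theorem sum_trace_mul_generalizedInverse_mul_le {d L V : Type*} [Fintype d] [Fintype L]
    [Fintype V] {ρ R : Matrix d d ℂ} {σ : V → Matrix d d ℂ} {φ : L → V → ℝ} {t : ℝ} (ht : 0 < t)
    (hσ : ∀ u, (σ u).PosSemidef) (hsum : ∑ u, σ u = ρ) (hR : R.IsHermitian)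
    (hRR : R * ρ * R = R) (hφ : ∀ u, ∑ l, φ l u ^ 2 ≤ t) :
    ∑ l, ((∑ u, (φ l u : ℂ) • σ u) * R * (∑ u, (φ l u : ℂ) • σ u)).trace.re ≤
      t * ρ.trace.re := by
  classical
  set Y : L → Matrix d d ℂ := fun l => ∑ u, (φ l u : ℂ) • σ u with hY
  set W : V → Matrix d d ℂ := fun u => ∑ l, (φ l u : ℂ) • (R * Y l) with hW
  set S : ℝ := ∑ l, (Y l * R * Y l).trace.re with hS
  change S ≤ _
  have hYh : ∀ l, (Y l).conjTranspose = Y l := by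
    intro l
    simp only [hY, Matrix.conjTranspose_sum, Matrix.conjTranspose_smul, (hσ _).1.eq,
      Complex.star_def, Complex.conj_ofReal]
  have hlin : ∑ u, (σ u * W u).trace.re = S := by
    simp only [hW, hS, Matrix.mul_sum, Matrix.trace_sum, Complex.re_sum]
    rw [Finset.sum_comm]
    refine Finset.sum_congr rfl fun l _ => ?_
    conv_rhs => rw [hY]
    simp only [Matrix.sum_mul, Matrix.trace_sum, Complex.re_sum, Matrix.mul_smul,
      Matrix.smul_mul, Matrix.mul_assoc]
    rfl
  have hquad : ∑ u, ((W u).conjTranspose * σ u * W u).trace.re ≤ t * S := by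
    calc ∑ u, ((W u).conjTranspose * σ u * W u).trace.re
        ≤ ∑ u, t * ∑ l, ((R * Y l).conjTranspose * σ u * (R * Y l)).trace.re := by
          refine Finset.sum_le_sum fun u _ => ?_
          refine ((hσ u).trace_conj_sum_smul_le (fun l => φ l u) (fun l => R * Y l)).trans ?_
          refine mul_le_mul_of_nonneg_right (hφ u) (Finset.sum_nonneg fun l _ => ?_)
          exact (Complex.le_def.mp ((hσ u).conjTranspose_mul_mul_same (R * Y l)).trace_nonneg).1
      _ = t * ∑ l, ((R * Y l).conjTranspose * ρ * (R * Y l)).trace.re := by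
          rw [← Finset.mul_sum, Finset.sum_comm, ← hsum]
          simp only [Matrix.mul_sum, Matrix.sum_mul, Matrix.trace_sum, Complex.re_sum]
      _ = t * S := by
          simp only [hS]
          congr 1
          refine Finset.sum_congr rfl fun l _ => ?_
          rw [Matrix.conjTranspose_mul, hYh, hR.eq]
          conv_rhs => rw [← hRR]
          simp only [Matrix.mul_assoc]
  -- Completing the square: this is the trace of `(t - W u)ᴴ * σ u * (t - W u)`. Summed over `u`,
  -- with `hlin` and `hquad`, it gives `0 ≤ t² tr ρ - 2tS + tS`.
  have hsq : ∀ u, 0 ≤ t ^ 2 * (σ u).trace.re - 2 * t * (σ u * W u).trace.re +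
      ((W u).conjTranspose * σ u * W u).trace.re := by
    intro u
    have h := (Complex.le_def.mp
      ((hσ u).conjTranspose_mul_mul_same ((t : ℂ) • (1 : Matrix d d ℂ) - W u)).trace_nonneg).1
    have hc : ((W u).conjTranspose * σ u).trace.re = (σ u * W u).trace.re := by
      have : (W u).conjTranspose * σ u = (σ u * W u).conjTranspose := by
        rw [Matrix.conjTranspose_mul, (hσ u).1.eq]
      rw [this, Matrix.trace_conjTranspose, Complex.star_def, Complex.conj_re]
    simp only [Matrix.conjTranspose_sub, Matrix.conjTranspose_smul, Matrix.conjTranspose_one,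
      Complex.star_def, Complex.conj_ofReal, Matrix.sub_mul, Matrix.mul_sub, Matrix.smul_mul,
      Matrix.mul_smul, Matrix.one_mul, Matrix.mul_one, Matrix.trace_sub, Matrix.trace_smul,
      Complex.sub_re, smul_eq_mul, Complex.re_ofReal_mul, Complex.zero_re, hc] at h
    nlinarith
  have htr : ∑ u, (σ u).trace.re = ρ.trace.re := by
    rw [← hsum, Matrix.trace_sum, Complex.re_sum]
  have h := Finset.sum_nonneg fun u (_ : u ∈ Finset.univ) => hsq u
  rw [Finset.sum_add_distrib, Finset.sum_sub_distrib, ← Finset.mul_sum, ← Finset.mul_sum, htr,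
    hlin] at h
  have : t * S ≤ t * (t * ρ.trace.re) := by nlinarith
  exact le_of_mul_le_mul_left this ht

/-- A certificate for the bound `t` on the Lovász number of `G`: real vectors indexed by the
vertices, with a common coordinate equal to `1`, of squared length at most `t`, and orthogonal
for distinct nonadjacent vertices. -/
def LovaszCertificate {V : Type*} (G : SimpleGraph V) (t : ℝ) : Prop :=
  ∃ (L : Type) (_ : Fintype L) (φ : L → V → ℝ) (l₀ : L), (∀ u, φ l₀ u = 1) ∧
    (∀ u, ∑ l, φ l u ^ 2 ≤ t) ∧ ∀ u v, u ≠ v → ¬ G.Adj u v → ∑ l, φ l u * φ l v = 0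

/-- The Lovász number bounds the entanglement-assisted independence number. -/
theorem EntangledSendable.le_of_lovaszCertificate {V : Type*} [Fintype V] {G : SimpleGraph V}
    {m : ℕ} {t : ℝ} (h : EntangledSendable G m) (ht : 0 < t) (hG : LovaszCertificate G t) :
    (m : ℝ) ≤ t := by
  obtain ⟨d, ρ, σ, hρ, hσ, htr, hsum, hort⟩ := h
  obtain ⟨L, _, φ, l₀, hφ₀, hφ, hφort⟩ := hG
  obtain ⟨R, hR, hRR, hρR⟩ := hρ.exists_generalizedInverse
  set Y : Fin m → L → Matrix (Fin d) (Fin d) ℂ := fun i l => ∑ u, (φ l u : ℂ) • σ i u with hY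
  set X : L → Matrix (Fin d) (Fin d) ℂ := fun l => ∑ i, Y i l with hX
  have hYh : ∀ i l, (Y i l).conjTranspose = Y i l := by
    intro i l
    simp only [hY, Matrix.conjTranspose_sum, Matrix.conjTranspose_smul, (hσ _ _).1.eq,
      Complex.star_def, Complex.conj_ofReal]
  have hXh : ∀ l, (X l).conjTranspose = X l := by
    intro l
    simp only [hX, Matrix.conjTranspose_sum, hYh]
  -- The sum over `l` of `tr (X l * R * X l)` is estimated twice: its `l₀` term alone is `m²`, while
  -- expanding over messages leaves `m` diagonal terms, each at most `t`.
  have hpos : ∀ l, 0 ≤ (X l * R * X l).trace.re := by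
    intro l
    have := (Complex.le_def.mp (hR.conjTranspose_mul_mul_same (X l)).trace_nonneg).1
    rwa [hXh] at this
  have h0 : (X l₀ * R * X l₀).trace.re = (m : ℝ) ^ 2 := by
    have : X l₀ = (m : ℂ) • ρ := by
      simp only [hX, hY, hφ₀, Complex.ofReal_one, one_smul, hsum]
      simp [Finset.sum_const, Nat.cast_smul_eq_nsmul]
    rw [this, Matrix.smul_mul, Matrix.smul_mul, Matrix.mul_smul, hρR, Matrix.trace_smul,
      Matrix.trace_smul, htr]
    simp [sq]
  have hcross : ∀ i j, i ≠ j → ∑ l, (Y i l * R * Y j l).trace = 0 := by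
    intro i j hij
    have : ∀ l, (Y i l * R * Y j l).trace =
        ∑ u, ∑ v, ((φ l u * φ l v : ℝ) : ℂ) * (σ i u * R * σ j v).trace := by
      intro l
      simp only [hY, Matrix.sum_mul, Matrix.mul_sum, Matrix.trace_sum, Matrix.smul_mul,
        Matrix.mul_smul, Matrix.trace_smul, smul_eq_mul, Complex.ofReal_mul]
      rw [Finset.sum_comm]
      refine Finset.sum_congr rfl fun u _ => ?_
      simp only [Finset.mul_sum]
      refine Finset.sum_congr rfl fun v _ => ?_
      ring
    simp only [this]
    rw [Finset.sum_comm]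
    refine Finset.sum_eq_zero fun u _ => ?_
    rw [Finset.sum_comm]
    refine Finset.sum_eq_zero fun v _ => ?_
    rw [← Finset.sum_mul, ← Complex.ofReal_sum]
    -- Either the operators annihilate each other, after cycling the trace, or the certificate
    -- vectors are orthogonal.
    by_cases huv : u = v ∨ G.Adj u v
    · have h1 : σ j v * σ i u = 0 :=
        hort j i hij.symm v u (huv.imp Eq.symm fun a => a.symm)
      rw [Matrix.trace_mul_comm, ← Matrix.mul_assoc, h1]
      simp
    · rw [not_or] at huv
      rw [hφort u v huv.1 huv.2]
      simp
  have htot : ∑ l, (X l * R * X l).trace.re = ∑ i, ∑ l, (Y i l * R * Y i l).trace.re := by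
    have : ∑ l, (X l * R * X l).trace = ∑ i, ∑ l, (Y i l * R * Y i l).trace := by
      simp only [hX, Matrix.sum_mul, Matrix.mul_sum, Matrix.trace_sum]
      rw [Finset.sum_comm]
      rw [Finset.sum_congr rfl fun j _ => Finset.sum_comm]
      refine Finset.sum_congr rfl fun j _ => ?_
      exact Finset.sum_eq_single j (fun i _ hi => hcross i j hi) (by simp)
    have h := congrArg Complex.re this
    simpa only [Complex.re_sum] using h
  have hle : ∀ i, ∑ l, (Y i l * R * Y i l).trace.re ≤ t := by
    intro i
    have := sum_trace_mul_generalizedInverse_mul_le ht (hσ i) (hsum i) hR.1 hRR hφ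
    rwa [htr, Complex.one_re, mul_one] at this
  have hfin : (m : ℝ) ^ 2 ≤ m * t := by
    calc (m : ℝ) ^ 2 = (X l₀ * R * X l₀).trace.re := h0.symm
      _ ≤ ∑ l, (X l * R * X l).trace.re :=
          Finset.single_le_sum (fun l _ => hpos l) (Finset.mem_univ l₀)
      _ ≤ ∑ _i : Fin m, t := by rw [htot]; exact Finset.sum_le_sum fun i _ => hle i
      _ = m * t := by simp
  rcases Nat.eq_zero_or_pos m with rfl | hm
  · simpa using ht.le
  · have hm' : (0 : ℝ) < m := by exact_mod_cast hm
    nlinarith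

/-- Tensor powers of a certificate are certificates for the strong power. -/
theorem LovaszCertificate.strongPower {V : Type*} {G : SimpleGraph V} {t : ℝ}
    (hG : LovaszCertificate G t) (n : ℕ) : LovaszCertificate (strongPower G n) (t ^ n) := by
  obtain ⟨L, _, φ, l₀, hφ₀, hφ, hφort⟩ := hG
  classical
  have hgram : ∀ u v : Fin n → V, ∑ l : Fin n → L, (∏ a, φ (l a) (u a)) * ∏ a, φ (l a) (v a) =
      ∏ a, ∑ l, φ l (u a) * φ l (v a) := by
    intro u v
    rw [Finset.prod_univ_sum, Fintype.piFinset_univ]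
    simp only [Finset.prod_mul_distrib]
  refine ⟨Fin n → L, inferInstance, fun l u => ∏ a, φ (l a) (u a), fun _ => l₀, ?_, ?_, ?_⟩
  · intro u
    simp [hφ₀]
  · intro u
    simp only [sq]
    rw [hgram]
    calc ∏ a, ∑ l, φ l (u a) * φ l (u a) ≤ ∏ _a : Fin n, t := by
          refine Finset.prod_le_prod (fun a _ => Finset.sum_nonneg fun l _ => mul_self_nonneg _)
            fun a _ => ?_
          simpa only [sq] using hφ (u a)
      _ = t ^ n := by simp
  · intro u v huv hadj
    rw [hgram]
    obtain ⟨a, ha⟩ : ∃ a, ¬ (u a = v a ∨ G.Adj (u a) (v a)) := by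
      by_contra! hcon
      exact hadj ⟨huv, hcon⟩
    rw [not_or] at ha
    exact Finset.prod_eq_zero (Finset.mem_univ a) (hφort _ _ ha.1 ha.2)

/-! ### Fourier analysis on the sign cube and middle Krawtchouk values -/

/-- The character of `{±1}^k` indexed by a set of coordinates. -/
def signCharacter {k : ℕ} (S : Finset (Fin k)) (x : Fin k → ℤˣ) : ℝ :=
  ∏ i ∈ S, ((x i : ℤ) : ℝ)

/-- The sign vectors whose entries sum to zero. -/
def balancedSigns (k : ℕ) : Finset (Fin k → ℤˣ) :=
  Finset.univ.filter fun x => ∑ i, (x i : ℤ) = 0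

theorem mem_balancedSigns {k : ℕ} {x : Fin k → ℤˣ} :
    x ∈ balancedSigns k ↔ ∑ i, (x i : ℤ) = 0 := by
  simp [balancedSigns]

/-- The sum of a character over the balanced sign vectors. -/
noncomputable def balancedSum {k : ℕ} (S : Finset (Fin k)) : ℝ :=
  ∑ x ∈ balancedSigns k, signCharacter S x

theorem signCharacter_mul {k : ℕ} (S : Finset (Fin k)) (x y : Fin k → ℤˣ) :
    signCharacter S (x * y) = signCharacter S x * signCharacter S y := by
  simp [signCharacter, Finset.prod_mul_distrib]

theorem sum_signCharacter {k : ℕ} (x : Fin k → ℤˣ) :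
    ∑ S : Finset (Fin k), signCharacter S x = if x = 1 then 2 ^ k else 0 := by
  have h : ∑ S : Finset (Fin k), signCharacter S x = ∏ i, (1 + ((x i : ℤ) : ℝ)) := by
    rw [Finset.prod_one_add, Finset.powerset_univ]
    rfl
  rw [h]
  split_ifs with hx
  · subst hx
    norm_num
  · obtain ⟨i, hi⟩ := Function.ne_iff.mp hx
    refine Finset.prod_eq_zero (Finset.mem_univ i) ?_
    rcases Int.units_eq_one_or (x i) with h1 | h1
    · exact absurd h1 hi
    · rw [h1]; simp

/-- Fourier inversion for the indicator of the balanced vectors, the connection set of `Ω_k` for `k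
≥ 1`; thus the `balancedSum S` are the eigenvalues of that graph. -/
theorem sum_balancedSum_mul_signCharacter {k : ℕ} (z : Fin k → ℤˣ) :
    ∑ S : Finset (Fin k), balancedSum S * signCharacter S z =
      if z ∈ balancedSigns k then 2 ^ k else 0 := by
  simp only [balancedSum, Finset.sum_mul, ← signCharacter_mul]
  rw [Finset.sum_comm]
  simp only [sum_signCharacter]
  have : ∀ x : Fin k → ℤˣ, x * z = 1 ↔ x = z := by
    intro x
    have hz : z⁻¹ = z := by
      funext i
      simp
    rw [mul_eq_one_iff_eq_inv, hz]
  simp only [this]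
  rw [Finset.sum_ite_eq']

/-- Coordinate permutations preserve balancedness, and some permutation carries `S` to `T`. -/
theorem balancedSum_eq_of_card_eq {k : ℕ} {S T : Finset (Fin k)} (h : S.card = T.card) :
    balancedSum S = balancedSum T := by
  classical
  let e : {i // i ∈ S} ≃ {i // i ∈ T} := Finset.equivOfCardEq h
  let τ : Equiv.Perm (Fin k) := e.extendSubtype
  have hτ : S.map τ.toEmbedding = T := by
    refine Finset.eq_of_subset_of_card_le (fun j hj => ?_) (by simp [h])
    obtain ⟨i, hi, rfl⟩ := Finset.mem_map.mp hj
    exact e.extendSubtype_mem i hi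
  unfold balancedSum
  refine Finset.sum_bij' (fun x _ => x ∘ τ.symm) (fun x _ => x ∘ τ) ?_ ?_ ?_ ?_ ?_
  · intro x hx
    rw [mem_balancedSigns] at hx ⊢
    rw [← hx]
    exact Equiv.sum_comp τ.symm fun i => (x i : ℤ)
  · intro x hx
    rw [mem_balancedSigns] at hx ⊢
    rw [← hx]
    exact Equiv.sum_comp τ fun i => (x i : ℤ)
  · intro x _
    funext i
    simp
  · intro x _
    funext i
    simp
  · intro x _
    simp [signCharacter, ← hτ]

/-- On balanced vectors `(∑ i, x i) * χ_S(x)` vanishes, and multiplying `χ_S` by `x i` removes `i`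
from `S` or adds it. -/
theorem sum_balancedSum_erase_add_sum_balancedSum_insert {k : ℕ} (S : Finset (Fin k)) :
    ∑ i ∈ S, balancedSum (S.erase i) + ∑ i ∈ Sᶜ, balancedSum (insert i S) = 0 := by
  have h : ∑ i, ∑ x ∈ balancedSigns k, ((x i : ℤ) : ℝ) * signCharacter S x = 0 := by
    rw [Finset.sum_comm]
    refine Finset.sum_eq_zero fun x hx => ?_
    rw [← Finset.sum_mul, ← Int.cast_sum, mem_balancedSigns.mp hx]
    simp
  rw [← h, ← Finset.sum_add_sum_compl S]
  congr 1
  · refine Finset.sum_congr rfl fun i hi => Finset.sum_congr rfl fun x _ => ?_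
    rw [signCharacter, signCharacter, ← Finset.mul_prod_erase S _ hi, ← mul_assoc]
    have : ((x i : ℤ) : ℝ) * ((x i : ℤ) : ℝ) = 1 := by
      rcases Int.units_eq_one_or (x i) with h1 | h1 <;> rw [h1] <;> simp
    rw [this, one_mul]
  · refine Finset.sum_congr rfl fun i hi => Finset.sum_congr rfl fun x _ => ?_
    rw [signCharacter, signCharacter, Finset.prod_insert (Finset.mem_compl.mp hi)]

/-- The three-term recurrence of the middle Krawtchouk polynomial. -/
theorem balancedSum_recurrence {k s : ℕ} {S T U : Finset (Fin k)} (hS : S.card = s)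
    (hT : T.card = s + 1) (hU : U.card = s + 2) :
    ((s : ℝ) + 1) * balancedSum S + ((k : ℝ) - s - 1) * balancedSum U = 0 := by
  have h := sum_balancedSum_erase_add_sum_balancedSum_insert T
  rw [Finset.sum_congr rfl fun i hi => balancedSum_eq_of_card_eq (T := S)
      (by rw [Finset.card_erase_of_mem hi]; omega),
    Finset.sum_congr rfl fun i hi => balancedSum_eq_of_card_eq (S := insert i T) (T := U)
      (by rw [Finset.card_insert_of_notMem (Finset.mem_compl.mp hi)]; omega),
    Finset.sum_const, Finset.sum_const, nsmul_eq_mul, nsmul_eq_mul, Finset.card_compl,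
    Nat.cast_sub (Finset.card_le_univ T), hT, Fintype.card_fin] at h
  push_cast at h
  linarith

theorem balancedSum_empty {k : ℕ} :
    balancedSum (∅ : Finset (Fin k)) = (balancedSigns k).card := by
  simp [balancedSum, signCharacter]

/-- Size `1` gives zero and size `2` gives equality. From `s` to `s + 2` the recurrence multiplies
the absolute value by `(s+1)/(k-s-1)`, which is at most `1` up to the middle level. -/
theorem mul_abs_balancedSum_le {k : ℕ} (hk : 2 ≤ k) (s : ℕ) :
    ∀ S : Finset (Fin k), S.card = s → 1 ≤ s → 2 * s ≤ k →
      ((k : ℝ) - 1) * |balancedSum S| ≤ (balancedSigns k).card := by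
  have hk1 : (0 : ℝ) < (k : ℝ) - 1 := by
    have : (2 : ℝ) ≤ k := by exact_mod_cast hk
    linarith
  induction s using Nat.strong_induction_on with
  | _ s ih =>
    intro U hU hs hsk
    rcases s with _ | _ | s
    · omega
    · have h := sum_balancedSum_erase_add_sum_balancedSum_insert (∅ : Finset (Fin k))
      rw [Finset.sum_empty, zero_add, Finset.sum_congr rfl fun i hi =>
        balancedSum_eq_of_card_eq (S := insert i ∅) (T := U) (by simp [hU])] at h
      simp only [Finset.compl_empty, Finset.sum_const, Finset.card_univ, Fintype.card_fin,
        nsmul_eq_mul, mul_eq_zero, Nat.cast_eq_zero] at h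
      rw [h.resolve_left (by omega)]
      simp
    · obtain ⟨T, hTU, hT⟩ := Finset.exists_subset_card_eq (s := U) (n := s + 1) (by omega)
      obtain ⟨S, hST, hS⟩ := Finset.exists_subset_card_eq (s := U) (n := s) (by omega)
      have hrec := balancedSum_recurrence hS hT hU
      rcases Nat.eq_zero_or_pos s with rfl | hs0
      · rw [Finset.card_eq_zero] at hS
        subst hS
        rw [balancedSum_empty] at hrec
        have : ((k : ℝ) - 1) * balancedSum U = -(balancedSigns k).card := by
          push_cast at hrec
          linarith
        rw [← abs_of_pos hk1, ← abs_mul, this, abs_neg, abs_of_nonneg (Nat.cast_nonneg _)]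
      · have hb := ih s (by omega) S hS hs0 (by omega)
        have hsk' : 2 * ((s : ℝ) + 1 + 1) ≤ k := by exact_mod_cast hsk
        have habs : ((s : ℝ) + 1) * |balancedSum S| = ((k : ℝ) - s - 1) * |balancedSum U| := by
          have hs1 : (0 : ℝ) < (s : ℝ) + 1 := by positivity
          have hs2 : (0 : ℝ) < (k : ℝ) - s - 1 := by linarith
          have h := congrArg abs (eq_neg_of_add_eq_zero_left hrec)
          rwa [abs_neg, abs_mul, abs_mul, abs_of_pos hs1, abs_of_pos hs2] at h
        have hle : |balancedSum U| ≤ |balancedSum S| := by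
          have hs1 : (0 : ℝ) < (s : ℝ) + 1 := by positivity
          refine le_of_mul_le_mul_left ?_ hs1
          rw [habs]
          exact mul_le_mul_of_nonneg_right (by linarith) (abs_nonneg _)
        exact (mul_le_mul_of_nonneg_left hle hk1.le).trans hb

theorem prod_eq_one_of_mem_balancedSigns {k : ℕ} (hk : 4 ∣ k) {x : Fin k → ℤˣ}
    (hx : x ∈ balancedSigns k) : ∏ i, ((x i : ℤ) : ℝ) = 1 := by
  classical
  rw [mem_balancedSigns] at hx
  set N : Finset (Fin k) := Finset.univ.filter fun i => x i = -1 with hN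
  have h1 : ∀ i, (x i : ℤ) = 1 - 2 * if x i = -1 then 1 else 0 := by
    intro i
    rcases Int.units_eq_one_or (x i) with h | h <;> rw [h] <;> simp
  have h2 : ∀ i, ((x i : ℤ) : ℝ) = if x i = -1 then -1 else 1 := by
    intro i
    rcases Int.units_eq_one_or (x i) with h | h <;> rw [h] <;> simp
  have hcard : (k : ℤ) = 2 * N.card := by
    rw [Finset.sum_congr rfl fun i _ => h1 i, Finset.sum_sub_distrib, ← Finset.mul_sum,
      Finset.sum_boole] at hx
    simp only [Finset.sum_const, Finset.card_univ, Fintype.card_fin, nsmul_eq_mul, mul_one] at hx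
    rw [hN]
    linarith
  have heven : Even N.card := by
    obtain ⟨j, rfl⟩ := hk
    exact ⟨j, by omega⟩
  rw [Finset.prod_congr rfl fun i _ => h2 i, Finset.prod_ite]
  simp only [Finset.prod_const, one_pow, mul_one]
  exact heven.neg_one_pow

/-- A balanced vector has `k/2` negative entries, an even number because `4 ∣ k`, so complementary
characters agree on it. This reduces large sets to those of size at most `k/2`. -/
theorem balancedSum_compl {k : ℕ} (hk : 4 ∣ k) (S : Finset (Fin k)) :
    balancedSum Sᶜ = balancedSum S := by
  refine Finset.sum_congr rfl fun x hx => ?_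
  have h1 : signCharacter S x * signCharacter Sᶜ x = 1 := by
    rw [← prod_eq_one_of_mem_balancedSigns hk hx]
    exact Finset.prod_mul_prod_compl S _
  have h2 : signCharacter S x * signCharacter S x = 1 := by
    rw [← signCharacter_mul, signCharacter]
    simp
  calc signCharacter Sᶜ x = (signCharacter S x * signCharacter S x) * signCharacter Sᶜ x := by
        rw [h2, one_mul]
    _ = signCharacter S x := by rw [mul_assoc, h1, mul_one]

/-- The smallest value of the middle Krawtchouk polynomial is attained at `2`. -/
theorem neg_card_le_mul_balancedSum {k : ℕ} (hk0 : 0 < k) (hk : 4 ∣ k) (S : Finset (Fin k)) :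
    -((balancedSigns k).card : ℝ) ≤ ((k : ℝ) - 1) * balancedSum S := by
  have hk4 : 4 ≤ k := Nat.le_of_dvd hk0 hk
  have hk1 : (0 : ℝ) < (k : ℝ) - 1 := by
    have : (4 : ℝ) ≤ k := by exact_mod_cast hk4
    linarith
  have key : ∀ S : Finset (Fin k), 2 * S.card ≤ k →
      -((balancedSigns k).card : ℝ) ≤ ((k : ℝ) - 1) * balancedSum S := by
    intro S hS
    rcases Nat.eq_zero_or_pos S.card with h0 | h0
    · rw [Finset.card_eq_zero] at h0
      subst h0
      rw [balancedSum_empty]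
      have : (0 : ℝ) ≤ (balancedSigns k).card := Nat.cast_nonneg _
      nlinarith
    · have h := mul_abs_balancedSum_le (by omega) _ S rfl h0 hS
      nlinarith [neg_abs_le (balancedSum S)]
  by_cases hS : 2 * S.card ≤ k
  · exact key S hS
  · rw [← balancedSum_compl hk]
    refine key _ ?_
    rw [Finset.card_compl, Fintype.card_fin]
    omega

theorem balancedSigns_nonempty {k : ℕ} (hk : Even k) : (balancedSigns k).Nonempty := by
  refine ⟨fun i => (-1) ^ (i : ℕ), ?_⟩
  rw [mem_balancedSigns]
  simp only [Units.val_pow_eq_pow_val, Units.val_neg, Units.val_one]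
  rw [Fin.sum_univ_eq_sum_range (fun i => (-1 : ℤ) ^ i), neg_one_geom_sum, if_pos hk]

/-! ### The Lovász certificate of the orthogonality graph -/

theorem lovaszCertificate_orthogonalityGraph {k : ℕ} (hk0 : 0 < k) (hk : 4 ∣ k) :
    LovaszCertificate (orthogonalityGraph k) (2 ^ k / k) := by
  set N : ℝ := ((balancedSigns k).card : ℝ) with hN
  have hNpos : 0 < N := by
    rw [hN, Nat.cast_pos, Finset.card_pos]
    obtain ⟨j, rfl⟩ := hk
    exact balancedSigns_nonempty ⟨2 * j, by ring⟩
  have hkpos : (0 : ℝ) < k := by exact_mod_cast hk0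
  -- Fourier weights of a function supported on `1` and the balanced vectors. The factor `k - 1` is
  -- the largest that keeps them nonnegative, and it makes `w ∅ = 1`, as the constant coordinate
  -- requires.
  set w : Finset (Fin k) → ℝ := fun S => (1 + ((k : ℝ) - 1) * balancedSum S / N) / k with hw
  have hw0 : ∀ S, 0 ≤ w S := by
    intro S
    have h := neg_card_le_mul_balancedSum hk0 hk S
    have : -1 ≤ ((k : ℝ) - 1) * balancedSum S / N := by
      rw [le_div_iff₀ hNpos]
      linarith
    exact div_nonneg (by linarith) hkpos.le
  have hgram : ∀ z : Fin k → ℤˣ, ∑ S, w S * signCharacter S z =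
      ((if z = 1 then 2 ^ k else 0) +
        ((k : ℝ) - 1) / N * (if z ∈ balancedSigns k then 2 ^ k else 0)) / k := by
    intro z
    rw [← sum_signCharacter, ← sum_balancedSum_mul_signCharacter, Finset.mul_sum,
      ← Finset.sum_add_distrib, Finset.sum_div]
    refine Finset.sum_congr rfl fun S _ => ?_
    simp only [hw]
    ring
  have hφ : ∀ u v : Fin k → ℤˣ, ∑ S, (√(w S) * signCharacter S u) * (√(w S) * signCharacter S v) =
      ∑ S, w S * signCharacter S (u * v) := by
    intro u v
    refine Finset.sum_congr rfl fun S _ => ?_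
    rw [signCharacter_mul, mul_mul_mul_comm, Real.mul_self_sqrt (hw0 S)]
  refine ⟨Finset (Fin k), inferInstance, fun S u => √(w S) * signCharacter S u, ∅, ?_, ?_, ?_⟩
  · intro u
    have : w ∅ = 1 := by
      simp only [hw, balancedSum_empty, ← hN]
      field_simp
      ring
    simp [this, signCharacter]
  · intro u
    simp only [sq]
    have h1 : u * u = 1 := by
      funext i
      simp
    have h2 : (1 : Fin k → ℤˣ) ∉ balancedSigns k := by
      rw [mem_balancedSigns]
      simp [hk0.ne']
    rw [hφ, hgram, h1, if_pos rfl, if_neg h2]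
    simp
  · intro u v huv hadj
    have h1 : u * v ≠ 1 := by
      intro h
      refine huv ?_
      have hv : v⁻¹ = v := by
        funext i
        simp
      rw [mul_eq_one_iff_eq_inv, hv] at h
      exact h
    have h2 : u * v ∉ balancedSigns k := by
      rw [mem_balancedSigns]
      intro h
      refine hadj ⟨huv, ?_⟩
      have := congrArg (Int.cast : ℤ → ℝ) h
      simpa using this
    rw [hφ, hgram, if_neg h1, if_neg h2]
    simp

/-! ### Tensor products of codes -/

theorem entangledSendable_card {V I D : Type*} [Fintype V] [Fintype I] [Fintype D]
    {G : SimpleGraph V} (ρ : Matrix D D ℂ) (σ : I → V → Matrix D D ℂ) (hρ : ρ.PosSemidef)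
    (hσ : ∀ i u, (σ i u).PosSemidef) (htr : ρ.trace = 1) (hsum : ∀ i, ∑ u, σ i u = ρ)
    (hort : ∀ i j, i ≠ j → ∀ u v, u = v ∨ G.Adj u v → σ i u * σ j v = 0) :
    EntangledSendable G (Fintype.card I) := by
  let e := (Fintype.equivFin D).symm
  let f := (Fintype.equivFin I).symm
  refine ⟨Fintype.card D, ρ.submatrix e e, fun i u => (σ (f i) u).submatrix e e,
    hρ.submatrix e, fun i u => (hσ _ u).submatrix e, ?_, fun i => ?_, fun i j hij u v huv => ?_⟩
  · rw [← htr]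
    exact Equiv.sum_comp e fun a => ρ a a
  · rw [← hsum (f i)]
    ext a b
    simp [Matrix.sum_apply]
  · rw [Matrix.submatrix_mul_equiv, hort _ _ (f.injective.ne hij) u v huv]
    rfl

/-- The tensor product of a finite family of matrices. -/
def Matrix.piTensor {n : ℕ} {D : Type*} (A : Fin n → Matrix D D ℂ) :
    Matrix (Fin n → D) (Fin n → D) ℂ :=
  Matrix.of fun x y => ∏ a, A a (x a) (y a)

theorem Matrix.piTensor_mul {n : ℕ} {D : Type*} [Fintype D] (A B : Fin n → Matrix D D ℂ) :
    Matrix.piTensor A * Matrix.piTensor B = Matrix.piTensor fun a => A a * B a := by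
  classical
  ext x y
  simp only [Matrix.piTensor, Matrix.mul_apply, Matrix.of_apply]
  rw [Finset.prod_univ_sum, Fintype.piFinset_univ]
  simp only [Finset.prod_mul_distrib]

theorem Matrix.trace_piTensor {n : ℕ} {D : Type*} [Fintype D] (A : Fin n → Matrix D D ℂ) :
    (Matrix.piTensor A).trace = ∏ a, (A a).trace := by
  classical
  simp only [Matrix.piTensor, Matrix.trace, Matrix.diag, Matrix.of_apply]
  rw [Finset.prod_univ_sum, Fintype.piFinset_univ]

theorem Matrix.sum_piTensor {n : ℕ} {V D : Type*} [Fintype V]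
    (A : Fin n → V → Matrix D D ℂ) :
    ∑ u : Fin n → V, Matrix.piTensor (fun a => A a (u a)) =
      Matrix.piTensor fun a => ∑ v, A a v := by
  classical
  ext x y
  simp only [Matrix.piTensor, Matrix.sum_apply, Matrix.of_apply]
  rw [Finset.prod_univ_sum, Fintype.piFinset_univ]

theorem Matrix.PosSemidef.piTensor {n : ℕ} {D : Type*} [Fintype D]
    {A : Fin n → Matrix D D ℂ} (hA : ∀ a, (A a).PosSemidef) :
    (Matrix.piTensor A).PosSemidef := by
  classical
  have : ∀ a, ∃ B, A a = star B * B := by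
    intro a
    open MatrixOrder Matrix.Norms.L2Operator in
    exact CStarAlgebra.nonneg_iff_eq_star_mul_self.mp (hA a).nonneg
  choose B hB using this
  have h : Matrix.piTensor A = (Matrix.piTensor B).conjTranspose * Matrix.piTensor B := by
    have h1 : (Matrix.piTensor B).conjTranspose = Matrix.piTensor fun a => star (B a) := by
      ext x y
      simp [Matrix.piTensor, Matrix.conjTranspose_apply]
    rw [h1, Matrix.piTensor_mul]
    exact congrArg _ (funext hB)
  rw [h]
  exact Matrix.posSemidef_conjTranspose_mul_self _

/-- Using entanglement-assisted codes in parallel. -/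
theorem EntangledSendable.strongPower {V : Type*} [Fintype V] {G : SimpleGraph V} {m : ℕ}
    (h : EntangledSendable G m) (n : ℕ) : EntangledSendable (strongPower G n) (m ^ n) := by
  obtain ⟨d, ρ, σ, hρ, hσ, htr, hsum, hort⟩ := h
  have hcard : Fintype.card (Fin n → Fin m) = m ^ n := by simp
  rw [← hcard]
  refine entangledSendable_card (Matrix.piTensor fun _ : Fin n => ρ)
    (fun i u => Matrix.piTensor fun a => σ (i a) (u a)) (.piTensor fun _ => hρ)
    (fun i u => .piTensor fun a => hσ _ _) ?_ (fun i => ?_) fun i j hij u v huv => ?_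
  · simp [Matrix.trace_piTensor, htr]
  · rw [Matrix.sum_piTensor fun a v => σ (i a) v]
    simp only [hsum]
  -- Distinct message tuples differ in some coordinate, and one vanishing factor kills the tensor
  -- product.
  · obtain ⟨a, ha⟩ := Function.ne_iff.mp hij
    have hz : σ (i a) (u a) * σ (j a) (v a) = 0 := by
      refine hort _ _ ha _ _ ?_
      rcases huv with rfl | huv
      · exact Or.inl rfl
      · exact huv.2 a
    rw [Matrix.piTensor_mul]
    ext x y
    exact Finset.prod_eq_zero (Finset.mem_univ a) (congrFun (congrFun hz (x a)) (y a))

/-! ### A perfect code for `k` copies of the orthogonality graph -/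

/-- The Fourier basis vector `c`, with signs `u`. -/
noncomputable def signedFourierVec {k : ℕ} (u : Fin k → ℤˣ) (c : Fin k) : Fin k → ℂ :=
  fun a => ((u a : ℤ) : ℂ) * Complex.exp (2 * Real.pi * Complex.I / k) ^ ((a : ℕ) * c)

theorem star_rootOfUnity_mul_self (k : ℕ) :
    star (Complex.exp (2 * Real.pi * Complex.I / k)) *
      Complex.exp (2 * Real.pi * Complex.I / k) = 1 := by
  rw [Complex.star_def, ← Complex.exp_conj, ← Complex.exp_add, Complex.exp_eq_one_iff]
  exact ⟨0, by simp [map_ofNat, neg_div]⟩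

/-- With a common index `c` the unimodular Fourier phases cancel, leaving the real inner product of
`u` and `v`. -/
theorem star_signedFourierVec_dotProduct {k : ℕ} {u v : Fin k → ℤˣ}
    (h : (orthogonalityGraph k).Adj u v) (c : Fin k) :
    star (signedFourierVec u c) ⬝ᵥ signedFourierVec v c = 0 := by
  have h1 : star (signedFourierVec u c) ⬝ᵥ signedFourierVec v c =
      ((∑ a, ((u a : ℤ) : ℝ) * ((v a : ℤ) : ℝ) : ℝ) : ℂ) := by
    rw [dotProduct, Complex.ofReal_sum]
    refine Finset.sum_congr rfl fun a _ => ?_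
    simp only [signedFourierVec, Pi.star_apply, star_mul', star_pow]
    rw [mul_mul_mul_comm, ← mul_pow, star_rootOfUnity_mul_self]
    simp
  rw [h1, h.2]
  simp

theorem sum_signedFourierVec {k : ℕ} (hk : 0 < k) (u : Fin k → ℤˣ) :
    ∑ c, Matrix.vecMulVec (signedFourierVec u c) (star (signedFourierVec u c)) =
      (k : ℂ) • (1 : Matrix (Fin k) (Fin k) ℂ) := by
  have hω := Complex.isPrimitiveRoot_exp k hk.ne'
  have hstar := star_rootOfUnity_mul_self k
  set ω := Complex.exp (2 * Real.pi * Complex.I / k) with hωdef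
  ext a b
  have h1 : (∑ c, Matrix.vecMulVec (signedFourierVec u c) (star (signedFourierVec u c))) a b =
      ((u a : ℤ) : ℂ) * ((u b : ℤ) : ℂ) * ∑ c ∈ Finset.range k, (ω ^ (a : ℕ) * star ω ^ (b : ℕ)) ^ c := by
    rw [Matrix.sum_apply, ← Fin.sum_univ_eq_sum_range fun c => (ω ^ (a : ℕ) * star ω ^ (b : ℕ)) ^ c,
      Finset.mul_sum]
    refine Finset.sum_congr rfl fun c _ => ?_
    simp only [Matrix.vecMulVec_apply, signedFourierVec, Pi.star_apply, star_mul', star_pow,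
      ← hωdef, mul_pow, ← pow_mul]
    simp only [Complex.star_def, map_intCast]
    ring
  rw [h1]
  by_cases hab : a = b
  · subst hab
    have h2 : ω ^ (a : ℕ) * star ω ^ (a : ℕ) = 1 := by
      rw [← mul_pow, mul_comm, hstar, one_pow]
    have h3 : ((u a : ℤ) : ℂ) * ((u a : ℤ) : ℂ) = 1 := by
      rcases Int.units_eq_one_or (u a) with h | h <;> rw [h] <;> simp
    rw [h2, h3]
    simp
  · have hne : ω ^ (a : ℕ) * star ω ^ (b : ℕ) ≠ 1 := by
      intro h
      have h2 : ω ^ (a : ℕ) = ω ^ (b : ℕ) := by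
        calc ω ^ (a : ℕ) = ω ^ (a : ℕ) * (star ω * ω) ^ (b : ℕ) := by rw [hstar]; simp
          _ = (ω ^ (a : ℕ) * star ω ^ (b : ℕ)) * ω ^ (b : ℕ) := by rw [mul_pow]; ring
          _ = ω ^ (b : ℕ) := by rw [h, one_mul]
      exact hab (Fin.ext (hω.pow_inj a.2 b.2 h2))
    have hone : (ω ^ (a : ℕ) * star ω ^ (b : ℕ)) ^ k = 1 := by
      rw [mul_pow, ← pow_mul, ← pow_mul, mul_comm (a : ℕ), mul_comm (b : ℕ), pow_mul, pow_mul,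
        ← star_pow, hω.pow_eq_one]
      simp
    have h0 : ∑ c ∈ Finset.range k, (ω ^ (a : ℕ) * star ω ^ (b : ℕ)) ^ c = 0 := by
      rw [geom_sum_eq hne, hone]
      simp
    rw [h0]
    simp [hab]

/-- Messages are the vertices of `Ω_k`. With a maximally entangled state, the sender of `i` measures
in the basis twisted by `i` and transmits vertex `i` in the copy named by the outcome. Confusable
inputs of distinct messages lie in the same copy, where the residual states are orthogonal. -/
theorem entangledSendable_disjointCopies_orthogonalityGraph {k : ℕ} (hk : 0 < k) :
    EntangledSendable (disjointCopies (orthogonalityGraph k) k) (2 ^ k) := by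
  classical
  have hcard : Fintype.card (Fin k → ℤˣ) = 2 ^ k := by simp
  rw [← hcard]
  have hk' : (k : ℂ) ≠ 0 := by exact_mod_cast hk.ne'
  have hk1 : (0 : ℂ) ≤ (k : ℂ)⁻¹ := by simp
  -- One factor `k⁻¹` normalizes the vectors, of squared length `k`; the other comes from `ρ`.
  refine entangledSendable_card ((k : ℂ)⁻¹ • (1 : Matrix (Fin k) (Fin k) ℂ))
    (fun i p => if p.1 = i then ((k : ℂ)⁻¹ * (k : ℂ)⁻¹) •
      Matrix.vecMulVec (signedFourierVec i p.2) (star (signedFourierVec i p.2)) else 0)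
    (Matrix.PosSemidef.one.smul hk1) (fun i p => ?_) ?_ (fun i => ?_) fun i j hij p q hpq => ?_
  · split_ifs
    · exact (Matrix.posSemidef_vecMulVec_self_star _).smul (mul_nonneg hk1 hk1)
    · exact Matrix.PosSemidef.zero
  · simp [Matrix.trace_smul, hk']
  · rw [Fintype.sum_prod_type, Finset.sum_eq_single i (fun u _ hu => by simp [hu]) (by simp)]
    simp only [if_true]
    rw [← Finset.smul_sum, sum_signedFourierVec hk, smul_smul, mul_assoc, inv_mul_cancel₀ hk',
      mul_one]
  · split_ifs with h1 h2
    · rcases hpq with rfl | hadj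
      · exact absurd (h1.symm.trans h2) hij
      · obtain ⟨hadj, hc⟩ := hadj
        rw [h1, h2] at hadj
        rw [Matrix.smul_mul, Matrix.mul_smul, Matrix.vecMulVec_mul_vecMulVec, hc,
          star_signedFourierVec_dotProduct hadj]
        simp
    all_goals simp

theorem mainTheorem8 (k : ℕ) (hk0 : 0 < k) (hk4 : 4 ∣ k) (hk2 : ∀ j : ℕ, k ≠ 2 ^ j)
    (n : ℕ) (hn : 1 ≤ n) :
    entIndepNum (strongPower (disjointCopies (orthogonalityGraph k) k) n) >
      k ^ n * entIndepNum (strongPower (orthogonalityGraph k) n) := by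
  have hlow : (2 ^ k) ^ n ≤ entIndepNum (strongPower (disjointCopies (orthogonalityGraph k) k) n) :=
    (entIndepNum_isGreatest _).2
      ((entangledSendable_disjointCopies_orthogonalityGraph hk0).strongPower n)
  have hkpos : (0 : ℝ) < k := by exact_mod_cast hk0
  have hup := (entIndepNum_isGreatest (strongPower (orthogonalityGraph k) n)).1
    |>.le_of_lovaszCertificate (by positivity)
      ((lovaszCertificate_orthogonalityGraph hk0 hk4).strongPower n)
  set m := entIndepNum (strongPower (orthogonalityGraph k) n)
  rw [div_pow, le_div_iff₀ (by positivity)] at hup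
  have hle : k ^ n * m ≤ (2 ^ k) ^ n := by
    rw [mul_comm]
    exact_mod_cast hup
  refine lt_of_lt_of_le (lt_of_le_of_ne hle fun heq => ?_) hlow
  -- Equality gives `k^n * m = 2^{kn}`, and `n ≥ 1` makes `k` divide the left side.
  have hdvd : k ∣ 2 ^ (k * n) := by
    rw [pow_mul, ← heq]
    exact (dvd_pow_self k (by omega)).mul_right m
  obtain ⟨j, -, hj⟩ := (Nat.dvd_prime_pow Nat.prime_two).mp hdvd
  exact hk2 j hj
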